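/- There is a sequence of real numbers $(\gamma_n)_{n\ge 0}$ (the Stirling coefficients) such that $$\Gamma(\lambda)\sim\sqrt{2\pi}\,\lambda^{\lambda-1/2}e^{-\lambda}\sum_{n=0}^{\infty}(-1)^n\frac{\gamma_n}{\lambda^n}\qquad(\lambda\to+\infty)$$ in the sense of Poincaré, that is, for every integer $N\ge 0$, $$\frac{\Gamma(\lambda)}{\sqrt{2\pi}\,\lambda^{\lambda-1/2}e^{-\lambda}}-\sum_{n=0}^{N-1}(-1)^n\frac{\gamma_n}{\lambda^n}=O(\lambda^{-N})\qquad(\lambda\to+\infty).$$ Moreover, any real sequence $(\gamma_n)$ with this property satisfies, for every integer $n\ge 0$, both $$\gamma_n=\sum_{k=0}^{2n}\frac{(-1)^n2^{n+k+1}\,\Gamma\!\left(3n+\frac32\right)}{\sqrt{\pi}\,(2n+2k+1)\,(2n-k)!}\sum_{j=0}^{k}\frac{(-1)^j\,s(2n+k+j,j)}{(k-j)!\,(2n+k+j)!}$$ and $$\gamma_n=\sum_{k=0}^{2n}\frac{(-1)^n2^{n}\,\Gamma\!\left(n+k+\frac12\right)}{\sqrt{\pi}}\sum_{j=0}^{k}\frac{2^j}{(k-j)!}\sum_{i=0}^{j}\frac{(-1)^i\,S(2n+j+i,i)}{(j-i)!\,(2n+j+i)!},$$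 where $s(m,j)$ denotes the signless (unsigned) Stirling numbers of the first kind (the number of permutations of $m$ elements with exactly $j$ cycles) and $S(m,j)$ denotes the Stirling numbers of the second kind (the number of partitions of an $m$-element set into $j$ nonempty blocks), with $s(0,0)=S(0,0)=1$. -/

import Mathlib

/-- Poincaré asymptotic expansion in inverse powers as `x → +∞`: `f x ~ ∑ c n / x ^ n`,
i.e. for every `N` the remainder after the first `N` terms is `O (1 / x ^ N)`. -/
def HasInversePowerExpansion (f : ℝ → ℝ) (c : ℕ → ℝ) : Prop :=
  ∀ N : ℕ, Asymptotics.IsBigO Filter.atTop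
    (fun x : ℝ => f x - ∑ n ∈ Finset.range N, c n / x ^ n) (fun x : ℝ => 1 / x ^ N)

/-- `γ` is a sequence of Stirling coefficients:
`Γ(x) ~ √(2π) x ^ (x - 1/2) e ^ (-x) ∑ (-1) ^ n γ n / x ^ n` as `x → +∞`. -/
def IsStirlingCoefficients (γ : ℕ → ℝ) : Prop :=
  HasInversePowerExpansion
    (fun x : ℝ => Real.Gamma x / (√(2 * Real.pi) * x ^ (x - 1 / 2) * Real.exp (-x)))
    (fun n => (-1) ^ n * γ n)

/-!
After scaling, the Gamma function is a Laplace integral in two ways. With `t = x e ^ u` in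
`Γ(x) = ∫ t ^ (x - 1) e ^ (-t) dt` and with `t = x (1 - w)` in `x Γ(x) = ∫ t ^ x e ^ (-t) dt`,
`Γ(x) x ^ (-x) e ^ x = ∫ exp (-x (e ^ u - 1 - u)) du = ∫_{w < 1} exp (-x (-log (1 - w) - w)) dw`.

Laplace's method to all orders (`IsLaplaceIntegrand.hasInversePowerExpansion`) applies to any phase
`φ` with Taylor series `P = u ^ 2 / 2 + ⋯` that is bounded below by a multiple of `min(u ^ 2, |u|)`.
In the scale `u = s / √x` the integrand is `exp (-(s ^ 2 / 2) F(u))` with `F = 2 φ / u ^ 2`;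
expanding the exponential in powers of `F - 1` leaves an error of order `x ^ (-K / 2)` with an
integrable majorant in `s`, and Gaussian moments give the coefficients
`2 ^ n / √π ∑_{k ≤ 2 n} (-1) ^ k / k! Γ(n + k + 1/2) [u ^ (2 n)] (2 P / u ^ 2 - 1) ^ k`
(`laplaceCoeff`). The existence of the Stirling coefficients follows, and since inverse power
expansions are unique (`HasInversePowerExpansion.unique`), both phases compute the same sequence.

For both phases `P = B - X` with `B = e ^ X - 1` or `B = -log (1 - X)`, and the powers of `B`
generate the Stirling numbers of the second and first kind (`coeff_exp_sub_one_pow`,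
`coeff_negLogOneSub_pow`). Expanding `(2 P / u ^ 2 - 1) ^ k` binomially for the first phase gives the
formula with `S(m, i)`. For the second phase the order of the two sums is interchanged, and the sum
over `k` has the closed form `∑_{k = j}^{N} Γ(α + k) / (k - j)! = Γ(α + N + 1) / ((α + j) (N - j)!)`
(`sum_Gamma_div_factorial`), which gives the formula with `s(m, j)`.
-/

open Filter Topology MeasureTheory Asymptotics

/-! ### Powers of `exp - 1` and of the logarithm, and Stirling numbers -/

/-- The coefficients of `(e ^ X - 1) ^ i / i!` are `S(m, i) / m!`. -/
theorem coeff_exp_sub_one_pow (m i : ℕ) :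
    PowerSeries.coeff m ((PowerSeries.exp ℝ - 1) ^ i) =
      (i.factorial : ℝ) * Nat.stirlingSecond m i / m.factorial := by
  induction m generalizing i with
  | zero =>
    cases i with
    | zero => simp
    | succ i => simp [PowerSeries.coeff_zero_eq_constantCoeff_apply]
  | succ m ih =>
    cases i with
    | zero => simp [PowerSeries.coeff_one]
    | succ i =>
      -- The recurrence is the differential equation `(B ^ (i + 1))' = (i + 1) (B + 1) B ^ i`.
      have hd : PowerSeries.derivative ℝ ((PowerSeries.exp ℝ - 1) ^ (i + 1)) =
          ((i + 1 : ℕ) : ℝ) • ((PowerSeries.exp ℝ - 1) ^ (i + 1)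
            + (PowerSeries.exp ℝ - 1) ^ i) := by
        rw [Derivation.leibniz_pow]
        simp only [map_sub, PowerSeries.derivative_exp, Derivation.map_one_eq_zero, sub_zero,
          Nat.add_sub_cancel, smul_eq_mul, ← Nat.cast_smul_eq_nsmul ℝ]
        congr 1
        ring
      have h := congrArg (PowerSeries.coeff m) hd
      rw [PowerSeries.coeff_derivative, PowerSeries.coeff_smul, map_add, ih, ih] at h
      have hm : (m : ℝ) + 1 ≠ 0 := by positivity
      rw [eq_div_of_mul_eq hm h, Nat.stirlingSecond_succ_succ, Nat.factorial_succ,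
        Nat.factorial_succ]
      have := m.factorial_ne_zero
      push_cast
      simp only [smul_eq_mul]
      field_simp

/-- The power series `-log (1 - X) = ∑ X ^ m / m`; the constant term is `0⁻¹ = 0`. -/
noncomputable def negLogOneSub : PowerSeries ℝ :=
  PowerSeries.mk fun m => (m : ℝ)⁻¹

/-- The coefficients of `(-log (1 - X)) ^ i / i!` are `s(m, i) / m!`. -/
theorem coeff_negLogOneSub_pow (m i : ℕ) :
    PowerSeries.coeff m (negLogOneSub ^ i) =
      (i.factorial : ℝ) * Nat.stirlingFirst m i / m.factorial := by
  have hder : (1 - PowerSeries.X) * PowerSeries.derivative ℝ negLogOneSub = 1 := by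
    have : PowerSeries.derivative ℝ negLogOneSub = PowerSeries.mk 1 := by
      ext n
      have : (n : ℝ) + 1 ≠ 0 := by positivity
      simp [PowerSeries.coeff_derivative, negLogOneSub, this]
    rw [this, mul_comm, PowerSeries.mk_one_mul_one_sub_eq_one]
  induction m generalizing i with
  | zero =>
    cases i with
    | zero => simp
    | succ i =>
      have h0 : PowerSeries.constantCoeff negLogOneSub = 0 := by
        rw [← PowerSeries.coeff_zero_eq_constantCoeff_apply, negLogOneSub, PowerSeries.coeff_mk,
          Nat.cast_zero, inv_zero]
      simp [h0]
  | succ m ih =>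
    cases i with
    | zero => simp [PowerSeries.coeff_one]
    | succ i =>
      -- The recurrence is the differential equation `(1 - X) (B ^ (i + 1))' = (i + 1) B ^ i`.
      have hd : PowerSeries.derivative ℝ (negLogOneSub ^ (i + 1)) =
          PowerSeries.X * PowerSeries.derivative ℝ (negLogOneSub ^ (i + 1)) +
          ((i + 1 : ℕ) : ℝ) • negLogOneSub ^ i := by
        rw [← sub_eq_iff_eq_add']
        rw [Derivation.leibniz_pow]
        simp only [Nat.add_sub_cancel, smul_eq_mul, ← Nat.cast_smul_eq_nsmul ℝ]
        calc _ = ((i + 1 : ℕ) : ℝ) • (negLogOneSub ^ i *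
              ((1 - PowerSeries.X) * PowerSeries.derivative ℝ negLogOneSub)) := by
                rw [mul_smul_comm, ← smul_sub]
                congr 1
                ring
          _ = _ := by rw [hder, mul_one]
      have hX : PowerSeries.coeff m
          (PowerSeries.X * PowerSeries.derivative ℝ (negLogOneSub ^ (i + 1))) =
          m * PowerSeries.coeff m (negLogOneSub ^ (i + 1)) := by
        cases m with
        | zero => simp
        | succ m =>
          rw [PowerSeries.coeff_succ_X_mul, PowerSeries.coeff_derivative]
          push_cast
          ring
      have h := congrArg (PowerSeries.coeff m) hd
      rw [map_add, hX, PowerSeries.coeff_derivative, PowerSeries.coeff_smul, ih, ih] at h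
      have hm : (m : ℝ) + 1 ≠ 0 := by positivity
      rw [eq_div_of_mul_eq hm h, Nat.stirlingFirst_succ_succ, Nat.factorial_succ,
        Nat.factorial_succ]
      have := m.factorial_ne_zero
      push_cast
      simp only [smul_eq_mul]
      field_simp

/-! ### Coefficients of powers of a phase series -/

theorem coeff_sub_X_pow (B : PowerSeries ℝ) (M j : ℕ) :
    PowerSeries.coeff (M + 2 * j) ((B - PowerSeries.X) ^ j) =
      ∑ i ∈ Finset.range (j + 1), (-1 : ℝ) ^ (j - i) * j.choose i *
        PowerSeries.coeff (M + j + i) (B ^ i) := by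
  rw [sub_eq_add_neg, add_pow, map_sum]
  refine Finset.sum_congr rfl fun i hi => ?_
  have hi : i ≤ j := Finset.mem_range_succ_iff.1 hi
  have h1 : B ^ i * (-PowerSeries.X) ^ (j - i) * (j.choose i : PowerSeries ℝ) =
      PowerSeries.C ((-1 : ℝ) ^ (j - i) * j.choose i) * (B ^ i * PowerSeries.X ^ (j - i)) := by
    rw [neg_pow]
    simp only [map_mul, map_pow, map_neg, map_one, map_natCast]
    ring
  have h2 : M + 2 * j = M + j + i + (j - i) := by omega
  rw [h1, PowerSeries.coeff_C_mul, h2, PowerSeries.coeff_mul_X_pow]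

/-- If the powers of `B` generate the array `a`, the powers of `B - X` generate the
alternating sums that occur in the formulas for the Stirling coefficients. -/
theorem coeff_sub_X_pow_of_array {B : PowerSeries ℝ} {a : ℕ → ℕ → ℕ}
    (ha : ∀ m i, PowerSeries.coeff m (B ^ i) = (i.factorial : ℝ) * a m i / m.factorial)
    (M j : ℕ) :
    PowerSeries.coeff (M + 2 * j) ((B - PowerSeries.X) ^ j) =
      (-1) ^ j * j.factorial * ∑ i ∈ Finset.range (j + 1),
        (-1 : ℝ) ^ i * (a (M + j + i) i : ℝ) /
          (((j - i).factorial : ℝ) * ((M + j + i).factorial : ℝ)) := by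
  rw [coeff_sub_X_pow, Finset.mul_sum]
  refine Finset.sum_congr rfl fun i hi => ?_
  have hi : i ≤ j := Finset.mem_range_succ_iff.1 hi
  have hs : (-1 : ℝ) ^ (j - i) = (-1) ^ j * (-1) ^ i := by
    rw [← pow_add, ← Nat.sub_add_cancel hi, Nat.add_sub_cancel, add_assoc, pow_add _ (j - i),
      ← two_mul, pow_mul]
    simp
  rw [ha, hs, Nat.cast_choose ℝ hi]
  have h1 := (j - i).factorial_ne_zero
  have h2 := i.factorial_ne_zero
  have h3 := (M + j + i).factorial_ne_zero
  field_simp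

/-- For a phase series `P = X ^ 2 / 2 + ⋯`, the series `2 P / X ^ 2`. The two lowest coefficients
of `P` are dropped. -/
noncomputable def normalizedPhase (P : PowerSeries ℝ) : PowerSeries ℝ :=
  PowerSeries.mk fun n => 2 * PowerSeries.coeff (n + 2) P

theorem X_sq_mul_normalizedPhase {P : PowerSeries ℝ} (h0 : PowerSeries.coeff 0 P = 0)
    (h1 : PowerSeries.coeff 1 P = 0) :
    PowerSeries.X ^ 2 * normalizedPhase P = PowerSeries.C 2 * P := by
  ext n
  rw [PowerSeries.coeff_X_pow_mul', PowerSeries.coeff_C_mul]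
  split_ifs with h
  · simp [normalizedPhase, Nat.sub_add_cancel h]
  · interval_cases n
    · rw [h0, mul_zero]
    · rw [h1, mul_zero]

theorem coeff_normalizedPhase_pow {P : PowerSeries ℝ} (h0 : PowerSeries.coeff 0 P = 0)
    (h1 : PowerSeries.coeff 1 P = 0) (m j : ℕ) :
    PowerSeries.coeff m (normalizedPhase P ^ j) =
      2 ^ j * PowerSeries.coeff (m + 2 * j) (P ^ j) := by
  rw [← PowerSeries.coeff_X_pow_mul _ (2 * j) m, pow_mul, ← mul_pow,
    X_sq_mul_normalizedPhase h0 h1, mul_pow, ← map_pow, PowerSeries.coeff_C_mul]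

/-! ### The Laplace coefficients of a phase series -/

/-- The `n`-th coefficient in the Laplace expansion of
`√(x / 2π) ∫ exp (-x φ(u)) du`, where `P = u ^ 2 / 2 + ⋯` is the Taylor series of `φ` at its
minimum `0`. The factor `Γ(n + k + 1/2)` is a Gaussian moment. -/
noncomputable def laplaceCoeff (P : PowerSeries ℝ) (n : ℕ) : ℝ :=
  2 ^ n / √Real.pi * ∑ k ∈ Finset.range (2 * n + 1),
    (-1) ^ k / (k.factorial : ℝ) * Real.Gamma ((n : ℝ) + k + 1 / 2) *
      PowerSeries.coeff (2 * n) ((normalizedPhase P - 1) ^ k)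

theorem coeff_sub_one_pow (F : PowerSeries ℝ) (m k : ℕ) :
    (-1) ^ k / (k.factorial : ℝ) * PowerSeries.coeff m ((F - 1) ^ k) =
      ∑ j ∈ Finset.range (k + 1), (-1 : ℝ) ^ j / ((k - j).factorial * j.factorial : ℝ) *
        PowerSeries.coeff m (F ^ j) := by
  rw [sub_eq_add_neg, add_pow, map_sum, Finset.mul_sum]
  refine Finset.sum_congr rfl fun j hj => ?_
  have hj : j ≤ k := Finset.mem_range_succ_iff.1 hj
  have h1 : F ^ j * (-1) ^ (k - j) * (k.choose j : PowerSeries ℝ) =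
      PowerSeries.C ((-1 : ℝ) ^ (k - j) * k.choose j) * F ^ j := by
    simp only [map_mul, map_pow, map_neg, map_one, map_natCast]
    ring
  have hs : (-1 : ℝ) ^ k * (-1) ^ (k - j) = (-1) ^ j := by
    obtain ⟨l, rfl⟩ := Nat.exists_eq_add_of_le hj
    rw [Nat.add_sub_cancel_left, pow_add, mul_assoc, ← pow_add, ← two_mul, pow_mul]
    simp
  rw [h1, PowerSeries.coeff_C_mul, Nat.cast_choose ℝ hj, ← hs]
  have h1 := (k - j).factorial_ne_zero
  have h2 := j.factorial_ne_zero
  have h3 := k.factorial_ne_zero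
  field_simp

theorem laplaceCoeff_eq_sum_phase_pow {P : PowerSeries ℝ} (h0 : PowerSeries.coeff 0 P = 0)
    (h1 : PowerSeries.coeff 1 P = 0) (n : ℕ) :
    laplaceCoeff P n = 2 ^ n / √Real.pi * ∑ k ∈ Finset.range (2 * n + 1),
      ∑ j ∈ Finset.range (k + 1), Real.Gamma ((n : ℝ) + k + 1 / 2) / (k - j).factorial *
        ((-1 : ℝ) ^ j * 2 ^ j / j.factorial *
          PowerSeries.coeff (2 * n + 2 * j) (P ^ j)) := by
  rw [laplaceCoeff]
  congr 1
  refine Finset.sum_congr rfl fun k _ => ?_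
  rw [mul_right_comm, coeff_sub_one_pow, Finset.sum_mul]
  refine Finset.sum_congr rfl fun j _ => ?_
  rw [coeff_normalizedPhase_pow h0 h1]
  ring

/-- Summation of Gamma quotients; the telescoping step is `Γ(s + 1) = s Γ(s)`. -/
theorem sum_Gamma_div_factorial {α : ℝ} (hα : 0 < α) {j N : ℕ} (hj : j ≤ N) :
    ∑ k ∈ Finset.Ico j (N + 1), Real.Gamma (α + k) / (k - j).factorial =
      Real.Gamma (α + N + 1) / ((α + j) * (N - j).factorial) := by
  induction N, hj using Nat.le_induction with
  | base =>
    have : α + j ≠ 0 := by positivity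
    simp [Real.Gamma_add_one this, this]
  | succ N hj ih =>
    rw [Finset.sum_Ico_succ_top (by omega), ih, Nat.succ_sub hj, Nat.factorial_succ]
    have h1 : α + j ≠ 0 := by positivity
    have h2 : α + N + 1 ≠ 0 := by positivity
    have h3 := (N - j).factorial_ne_zero
    have h4 : α + ((N + 1 : ℕ) : ℝ) = α + N + 1 := by push_cast; ring
    rw [h4, Real.Gamma_add_one h2]
    have h5 : ((N - j : ℕ) : ℝ) = N - j := by rw [Nat.cast_sub hj]
    have h6 : (N : ℝ) - j + 1 ≠ 0 := by rw [← h5]; positivity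
    push_cast
    rw [h5]
    field_simp
    ring

/-- The double sum for the Laplace coefficient collapses after an interchange of summations. -/
theorem laplaceCoeff_eq_single_sum {P : PowerSeries ℝ} (h0 : PowerSeries.coeff 0 P = 0)
    (h1 : PowerSeries.coeff 1 P = 0) (n : ℕ) :
    laplaceCoeff P n = 2 ^ n / √Real.pi * ∑ j ∈ Finset.range (2 * n + 1),
      Real.Gamma (3 * (n : ℝ) + 3 / 2) / (((n : ℝ) + 1 / 2 + j) * (2 * n - j).factorial) *
        ((-1 : ℝ) ^ j * 2 ^ j / j.factorial *
          PowerSeries.coeff (2 * n + 2 * j) (P ^ j)) := by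
  rw [laplaceCoeff_eq_sum_phase_pow h0 h1]
  congr 1
  simp only [Finset.range_eq_Ico]
  rw [Finset.sum_comm' (t' := Finset.Ico 0 (2 * n + 1))
      (s' := fun j => Finset.Ico j (2 * n + 1))
      (by intro x y; simp only [Finset.mem_Ico]; omega)]
  refine Finset.sum_congr rfl fun j hj => ?_
  rw [← Finset.sum_mul]
  congr 1
  have hj : j ≤ 2 * n := by simp only [Finset.mem_Ico] at hj; omega
  have := sum_Gamma_div_factorial (α := (n : ℝ) + 1 / 2) (by positivity) hj
  have e : (n : ℝ) + 1 / 2 + ((2 * n : ℕ) : ℝ) + 1 = 3 * (n : ℝ) + 3 / 2 := by push_cast; ring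
  rw [e] at this
  rw [← this]
  refine Finset.sum_congr rfl fun k _ => ?_
  congr 2
  ring

/-! ### Taylor series as asymptotic expansions -/

/-- The power series `P` is the asymptotic Taylor series of `f` at `0`. Only a punctured
neighbourhood is involved, so that `f` may be a quotient with a removable singularity. -/
def HasTaylorSeries (f : ℝ → ℝ) (P : PowerSeries ℝ) : Prop :=
  ∀ K : ℕ, (fun u => f u - (P.trunc K).eval u) =O[𝓝[≠] 0] (fun u : ℝ => u ^ K)

theorem isBigO_eval_one (p : Polynomial ℝ) :
    (fun u => p.eval u) =O[𝓝[≠] 0] (fun _ : ℝ => (1 : ℝ)) :=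
  (p.continuous.tendsto 0).isBigO_one ℝ |>.mono nhdsWithin_le_nhds

theorem HasTaylorSeries.sub {f g : ℝ → ℝ} {P Q : PowerSeries ℝ} (hf : HasTaylorSeries f P)
    (hg : HasTaylorSeries g Q) : HasTaylorSeries (fun u => f u - g u) (P - Q) := fun K => by
  refine ((hf K).sub (hg K)).congr_left fun u => ?_
  rw [map_sub, Polynomial.eval_sub]
  ring

theorem HasTaylorSeries.mul {f g : ℝ → ℝ} {P Q : PowerSeries ℝ} (hf : HasTaylorSeries f P)
    (hg : HasTaylorSeries g Q) : HasTaylorSeries (fun u => f u * g u) (P * Q) := fun K => by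
  have hg1 : g =O[𝓝[≠] 0] (fun _ : ℝ => (1 : ℝ)) := by simpa using hg 0
  obtain ⟨r, hr⟩ : Polynomial.X ^ K ∣ P.trunc K * Q.trunc K - (P * Q).trunc K := by
    rw [Polynomial.X_pow_dvd_iff]
    intro d hd
    have := congrArg (fun p => Polynomial.coeff p d) (PowerSeries.trunc_trunc_mul_trunc (n := K) P Q)
    simp only [PowerSeries.coeff_trunc, if_pos hd] at this
    rw [Polynomial.coeff_sub, PowerSeries.coeff_trunc, if_pos hd, ← this,
      ← Polynomial.coe_mul, Polynomial.coeff_coe, sub_self]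
  have h1 := (hf K).mul hg1
  have h2 := (isBigO_eval_one (P.trunc K)).mul (hg K)
  have h3 := (isBigO_refl (fun u : ℝ => u ^ K) (𝓝[≠] 0)).mul (isBigO_eval_one r)
  simp only [mul_one, one_mul] at h1 h2 h3
  refine ((h1.add h2).add h3).congr_left fun u => ?_
  have := congrArg (Polynomial.eval u) hr
  simp only [Polynomial.eval_sub, Polynomial.eval_mul, Polynomial.eval_pow,
    Polynomial.eval_X] at this
  rw [← this]
  ring

theorem hasTaylorSeries_coe (p : Polynomial ℝ) : HasTaylorSeries (fun u => p.eval u) p :=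
  fun K => by
    obtain ⟨r, hr⟩ : Polynomial.X ^ K ∣ p - (p : PowerSeries ℝ).trunc K := by
      rw [Polynomial.X_pow_dvd_iff]
      intro d hd
      simp [PowerSeries.coeff_trunc, hd]
    refine ((isBigO_refl (fun u : ℝ => u ^ K) (𝓝[≠] 0)).mul (isBigO_eval_one r)).congr'
      (.of_forall fun u => ?_) (.of_forall fun u => mul_one _)
    beta_reduce
    rw [← Polynomial.eval_sub, hr]
    simp

theorem hasTaylorSeries_one : HasTaylorSeries (fun _ => 1) 1 := by
  simpa using hasTaylorSeries_coe 1

theorem hasTaylorSeries_id : HasTaylorSeries (fun u => u) PowerSeries.X := by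
  simpa using hasTaylorSeries_coe Polynomial.X

theorem HasTaylorSeries.pow {f : ℝ → ℝ} {P : PowerSeries ℝ} (hf : HasTaylorSeries f P) (k : ℕ) :
    HasTaylorSeries (fun u => f u ^ k) (P ^ k) := by
  induction k with
  | zero => simpa using hasTaylorSeries_one
  | succ k ih => simpa only [pow_succ] using ih.mul hf

theorem eval_trunc (P : PowerSeries ℝ) (K : ℕ) (u : ℝ) :
    (P.trunc K).eval u = ∑ i ∈ Finset.range K, PowerSeries.coeff i P * u ^ i := by
  simpa [Polynomial.eval₂_id] using PowerSeries.eval₂_trunc_eq_sum_range u (RingHom.id ℝ) K P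

theorem hasTaylorSeries_exp : HasTaylorSeries Real.exp (PowerSeries.exp ℝ) := fun K => by
  refine ((Real.exp_sub_sum_range_isBigO_pow K).mono nhdsWithin_le_nhds).congr_left fun u => ?_
  rw [eval_trunc]
  simp [PowerSeries.coeff_exp, div_eq_inv_mul]

theorem hasTaylorSeries_negLogOneSub :
    HasTaylorSeries (fun u => -Real.log (1 - u)) negLogOneSub := fun K => by
  cases K with
  | zero =>
    have : ContinuousAt (fun u : ℝ => -Real.log (1 - u)) 0 := by fun_prop (disch := norm_num)
    simpa using (this.tendsto.isBigO_one ℝ).mono nhdsWithin_le_nhds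
  | succ K =>
    refine IsBigO.mono (.of_bound 2 ?_) nhdsWithin_le_nhds
    filter_upwards [Metric.ball_mem_nhds (0 : ℝ) (show (0 : ℝ) < 1 / 2 by norm_num)] with u hu
    have hu : |u| < 1 / 2 := by simpa using hu
    have h := Real.abs_log_sub_add_sum_range_le (show |u| < 1 by linarith) K
    have e : -Real.log (1 - u) - (negLogOneSub.trunc (K + 1)).eval u =
        -((∑ i ∈ Finset.range K, u ^ (i + 1) / (i + 1)) + Real.log (1 - u)) := by
      rw [eval_trunc, Finset.sum_range_succ']
      simp [negLogOneSub, div_eq_inv_mul]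
      ring
    rw [e, norm_neg, Real.norm_eq_abs, norm_pow, Real.norm_eq_abs]
    refine h.trans ?_
    rw [div_le_iff₀ (by linarith)]
    nlinarith [pow_nonneg (abs_nonneg u) (K + 1)]

theorem HasTaylorSeries.normalizedPhase {φ : ℝ → ℝ} {P : PowerSeries ℝ}
    (hφ : HasTaylorSeries φ P) (h0 : PowerSeries.coeff 0 P = 0)
    (h1 : PowerSeries.coeff 1 P = 0) :
    HasTaylorSeries (fun u => 2 * φ u / u ^ 2) (normalizedPhase P) := fun K => by
  have h := ((hφ (K + 2)).const_mul_left 2).mul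
    (isBigO_refl (fun u : ℝ => (u ^ 2)⁻¹) (𝓝[≠] 0))
  refine h.congr' ?_ ?_
  · filter_upwards [self_mem_nhdsWithin] with u hu
    have hu : u ≠ 0 := hu
    rw [eval_trunc, eval_trunc, Finset.sum_range_succ', Finset.sum_range_succ', zero_add, h0, h1,
      zero_mul, zero_mul, add_zero, add_zero, mul_sub, Finset.mul_sum, sub_mul, Finset.sum_mul]
    congr 1
    refine Finset.sum_congr rfl fun i _ => ?_
    simp only [_root_.normalizedPhase, PowerSeries.coeff_mk]
    field_simp
    ring
  · filter_upwards [self_mem_nhdsWithin] with u hu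
    have hu : u ≠ 0 := hu
    field_simp
    ring

/-! ### Weights and Gaussian moments -/

/-- Every weight that occurs in the error estimates is dominated by the single integrable function
`1 / (1 + s ^ 2)`. -/
theorem exists_weight_bound (L : ℕ) {a : ℝ} (ha : 0 < a) :
    ∃ C, 0 ≤ C ∧ ∀ s : ℝ, (1 + |s|) ^ L * Real.exp (-(a * |s|)) ≤ C * (1 + s ^ 2)⁻¹ := by
  refine ⟨(L + 2).factorial / a ^ (L + 2) * Real.exp a, by positivity, fun s => ?_⟩
  have h := Real.pow_div_factorial_le_exp (x := a * (1 + |s|)) (by positivity) (L + 2)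
  rw [div_le_iff₀ (by positivity), mul_pow, pow_add (1 + |s|)] at h
  have h1 : 1 + s ^ 2 ≤ (1 + |s|) ^ 2 := by nlinarith [abs_nonneg s, sq_abs s]
  have h2 : Real.exp (a * (1 + |s|)) = Real.exp a * Real.exp (a * |s|) := by
    rw [← Real.exp_add]; ring_nf
  rw [← div_eq_mul_inv, le_div_iff₀ (by positivity), Real.exp_neg, div_mul_eq_mul_div,
    ← div_eq_mul_inv, div_mul_eq_mul_div, div_le_div_iff₀ (by positivity) (by positivity)]
  rw [h2] at h
  calc (1 + |s|) ^ L * (1 + s ^ 2) * a ^ (L + 2)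
      ≤ (1 + |s|) ^ L * (1 + |s|) ^ 2 * a ^ (L + 2) := by gcongr
    _ = a ^ (L + 2) * ((1 + |s|) ^ L * (1 + |s|) ^ 2) := by ring
    _ ≤ _ := h
    _ = _ := by ring

theorem integrable_pow_mul_gaussian (r : ℕ) :
    Integrable fun s : ℝ => s ^ r * Real.exp (-(s ^ 2 / 2)) := by
  have := integrable_rpow_mul_exp_neg_mul_sq (b := 1 / 2) (by norm_num) (s := r)
    (by have : (0 : ℝ) ≤ r := by positivity
        linarith)
  refine this.congr (.of_forall fun s => ?_)
  simp only [Real.rpow_natCast]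
  ring_nf

theorem integral_odd_pow_mul_gaussian {r : ℕ} (hr : Odd r) :
    ∫ s : ℝ, s ^ r * Real.exp (-(s ^ 2 / 2)) = 0 := by
  have := integral_neg_eq_self (fun s : ℝ => s ^ r * Real.exp (-(s ^ 2 / 2))) volume
  simp only [hr.neg_pow, neg_sq, neg_mul, integral_neg] at this
  linarith

theorem integral_even_pow_mul_gaussian (p : ℕ) :
    ∫ s : ℝ, s ^ (2 * p) * Real.exp (-(s ^ 2 / 2)) =
      √2 * 2 ^ p * Real.Gamma ((p : ℝ) + 1 / 2) := by
  have h := integral_comp_abs (f := fun s : ℝ => s ^ (2 * p) * Real.exp (-(s ^ 2 / 2)))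
  simp only [sq_abs, pow_mul] at h
  simp only [pow_mul]
  rw [h]
  have h2 := integral_rpow_mul_exp_neg_mul_rpow (p := 2) (q := 2 * p) (b := 1 / 2) (by norm_num)
    (by have : (0 : ℝ) ≤ p := by positivity
        linarith) (by norm_num)
  have h3 : ∫ s : ℝ in Set.Ioi 0, (s ^ 2) ^ p * Real.exp (-(s ^ 2 / 2)) =
      ∫ s : ℝ in Set.Ioi 0, s ^ (2 * (p : ℝ)) * Real.exp (-(1 / 2) * s ^ (2 : ℝ)) := by
    refine setIntegral_congr_fun measurableSet_Ioi fun s hs => ?_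
    have e : s ^ (2 * (p : ℝ)) = (s ^ 2) ^ p := by
      rw [← pow_mul, ← Real.rpow_natCast]; push_cast; rfl
    have e2 : s ^ (2 : ℝ) = s ^ 2 := by exact_mod_cast Real.rpow_natCast s 2
    simp only [e, e2]
    ring_nf
  rw [h3, h2]
  have e : (2 * (p : ℝ) + 1) / 2 = p + 1 / 2 := by ring
  have e3 : ((1 : ℝ) / 2) ^ (-((p : ℝ) + 1 / 2)) = 2 ^ p * √2 := by
    rw [one_div, Real.inv_rpow (by norm_num), Real.rpow_neg (by norm_num), inv_inv,
      Real.rpow_add (by norm_num), Real.rpow_natCast, Real.sqrt_eq_rpow, one_div]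
  have e4 : -(2 * (p : ℝ) + 1) / 2 = -((p : ℝ) + 1 / 2) := by ring
  rw [e4, e3, e]
  ring

/-! ### Laplace's method to all orders -/

/-- The approximation of `exp (-(s ^ 2 / 2) (1 + x(ε s)))` obtained by expanding the exponential
series in `x` to order `K` and replacing every power of `x` by the truncation of the corresponding
power of its Taylor series `Q`. -/
noncomputable def laplaceTruncation (Q : PowerSeries ℝ) (K : ℕ) (ε s : ℝ) : ℝ :=
  ∑ k ∈ Finset.range K, ∑ m ∈ Finset.range K,
    (-1 / 2) ^ k / (k.factorial : ℝ) * PowerSeries.coeff m (Q ^ k) * ε ^ m *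
      (s ^ (2 * k + m) * Real.exp (-(s ^ 2 / 2)))

theorem abs_exp_sub_sum_le (y : ℝ) (K : ℕ) :
    |Real.exp y - ∑ k ∈ Finset.range K, y ^ k / k.factorial| ≤ |y| ^ K * Real.exp |y| := by
  have := Complex.norm_exp_sub_sum_le_norm_mul_exp y K
  rw [Complex.norm_real, Real.norm_eq_abs] at this
  rw [← Real.norm_eq_abs, ← Complex.norm_real]
  push_cast
  exact this

theorem laplaceTruncation_eq (Q : PowerSeries ℝ) (K : ℕ) (ε s : ℝ) :
    laplaceTruncation Q K ε s = Real.exp (-(s ^ 2 / 2)) * ∑ k ∈ Finset.range K,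
      (-(s ^ 2 / 2)) ^ k / k.factorial * ((Q ^ k).trunc K).eval (ε * s) := by
  rw [laplaceTruncation, Finset.mul_sum]
  refine Finset.sum_congr rfl fun k _ => ?_
  rw [eval_trunc, Finset.mul_sum, Finset.mul_sum]
  refine Finset.sum_congr rfl fun m _ => ?_
  have e : -(s ^ 2 / 2) = -1 / 2 * s ^ 2 := by ring
  rw [e, mul_pow (-1 / 2 : ℝ), mul_pow ε, pow_add, pow_mul]
  ring

/-- Error of the truncation close to the minimum, where the quadratic part of the phase
dominates. -/
theorem exists_laplaceTruncation_near {x : ℝ → ℝ} {Q : PowerSeries ℝ} (hx : HasTaylorSeries x Q)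
    (hQ : PowerSeries.coeff 0 Q = 0) (K : ℕ) :
    ∃ C, 0 ≤ C ∧ ∀ᶠ u in 𝓝[≠] 0, ∀ ε s : ℝ, 0 < ε → ε * s = u →
      |Real.exp (-(s ^ 2 / 2 * (1 + x u))) - laplaceTruncation Q K ε s| ≤
        C * ε ^ K * ((1 + |s|) ^ (3 * K) * Real.exp (-(s ^ 2 / 4))) := by
  have hx1 : x =O[𝓝[≠] 0] (fun u : ℝ => u) := by
    have := hx 1
    simp only [eval_trunc, Finset.sum_range_one, hQ, zero_mul, sub_zero, pow_one] at this
    exact this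
  obtain ⟨C₁, hC₁, hx1⟩ := hx1.exists_nonneg
  have hpow := fun k => (hx.pow k K).exists_nonneg
  choose D hD0 hD using hpow
  refine ⟨C₁ ^ K + ∑ k ∈ Finset.range K, D k,
    add_nonneg (pow_nonneg hC₁ K) (Finset.sum_nonneg fun k _ => hD0 k), ?_⟩
  have hsmall : ∀ᶠ u in 𝓝[≠] (0 : ℝ), C₁ * |u| ≤ 1 / 2 := by
    have : Tendsto (fun u : ℝ => C₁ * |u|) (𝓝[≠] 0) (𝓝 0) := by
      have : Continuous fun u : ℝ => C₁ * |u| := by fun_prop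
      exact (this.tendsto' 0 0 (by simp)).mono_left nhdsWithin_le_nhds
    exact this.eventually_le_const (by norm_num)
  have hall : ∀ᶠ u in 𝓝[≠] (0 : ℝ), ∀ k ∈ Finset.range K,
      ‖x u ^ k - ((Q ^ k).trunc K).eval u‖ ≤ D k * ‖u ^ K‖ :=
    (Finset.eventually_all (Finset.range K)).2 fun k _ => (hD k).bound
  filter_upwards [hsmall, hall, hx1.bound] with u hu1 hu2 hu3 ε s hε hsu
  rw [Real.norm_eq_abs, Real.norm_eq_abs] at hu3
  set y := -(s ^ 2 / 2) * x u with hy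
  set w := 1 + |s| with hw
  have hw1 : 1 ≤ w := by rw [hw]; linarith [abs_nonneg s]
  have hsw : |s| ≤ w := by rw [hw]; linarith
  have hs2 : s ^ 2 / 2 ≤ w ^ 2 := by nlinarith [sq_abs s, abs_nonneg s]
  have hua : |u| = ε * |s| := by rw [← hsu, abs_mul, abs_of_pos hε]
  have hya : |y| = s ^ 2 / 2 * |x u| := by
    rw [hy, abs_mul, abs_neg, abs_of_nonneg (by positivity : 0 ≤ s ^ 2 / 2)]
  have hy1 : |y| ≤ s ^ 2 / 4 := by
    rw [hya]; nlinarith [sq_nonneg s]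
  have hy2 : |y| ≤ C₁ * ε * w ^ 3 := by
    rw [hya]
    calc s ^ 2 / 2 * |x u| ≤ w ^ 2 * (C₁ * (ε * w)) := by
          rw [hua] at hu3
          gcongr
          exact hu3.trans (by gcongr)
      _ = _ := by ring
  have h1 : |Real.exp y - ∑ k ∈ Finset.range K, y ^ k / k.factorial| ≤
      C₁ ^ K * (ε ^ K * w ^ (3 * K) * Real.exp (s ^ 2 / 4)) := by
    refine (abs_exp_sub_sum_le y K).trans ?_
    calc |y| ^ K * Real.exp |y| ≤ (C₁ * ε * w ^ 3) ^ K * Real.exp (s ^ 2 / 4) := by gcongr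
      _ = _ := by rw [mul_pow, mul_pow, ← pow_mul]; ring
  have h2 : |∑ k ∈ Finset.range K, y ^ k / k.factorial - ∑ k ∈ Finset.range K,
      (-(s ^ 2 / 2)) ^ k / k.factorial * ((Q ^ k).trunc K).eval u| ≤
      (∑ k ∈ Finset.range K, D k) * (ε ^ K * w ^ (3 * K) * Real.exp (s ^ 2 / 4)) := by
    rw [← Finset.sum_sub_distrib, Finset.sum_mul]
    refine (Finset.abs_sum_le_sum_abs _ _).trans (Finset.sum_le_sum fun k hk => ?_)
    have hk' : k ≤ K := (Finset.mem_range.1 hk).le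
    have e : y ^ k / k.factorial - (-(s ^ 2 / 2)) ^ k / k.factorial * ((Q ^ k).trunc K).eval u =
        (-(s ^ 2 / 2)) ^ k / k.factorial * (x u ^ k - ((Q ^ k).trunc K).eval u) := by
      rw [hy, mul_pow]; ring
    have h := hu2 k hk
    rw [Real.norm_eq_abs, norm_pow, Real.norm_eq_abs, hua] at h
    have hfac : (1 : ℝ) ≤ k.factorial := by exact_mod_cast k.factorial_pos
    have hk1 : |(-(s ^ 2 / 2)) ^ k / k.factorial| ≤ w ^ (2 * K) := by
      rw [abs_div, abs_pow, abs_neg, abs_of_nonneg (by positivity : 0 ≤ s ^ 2 / 2), Nat.abs_cast]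
      calc (s ^ 2 / 2) ^ k / k.factorial ≤ (s ^ 2 / 2) ^ k := div_le_self (by positivity) hfac
        _ ≤ (w ^ 2) ^ k := by gcongr
        _ = w ^ (2 * k) := by rw [pow_mul]
        _ ≤ _ := pow_le_pow_right₀ hw1 (by omega)
    rw [e, abs_mul]
    calc _ ≤ w ^ (2 * K) * (D k * (ε * w) ^ K) := by
          have := hD0 k
          gcongr
          exact h.trans (by gcongr)
      _ = D k * (ε ^ K * w ^ (3 * K) * 1) := by
          rw [mul_pow, show 3 * K = 2 * K + K by ring, pow_add]; ring
      _ ≤ _ := by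
          have := hD0 k
          gcongr
          exact Real.one_le_exp (by positivity)
  have e1 : Real.exp (-(s ^ 2 / 2 * (1 + x u))) = Real.exp (-(s ^ 2 / 2)) * Real.exp y := by
    rw [← Real.exp_add, hy]; ring_nf
  have e2 : Real.exp (-(s ^ 2 / 4)) = Real.exp (-(s ^ 2 / 2)) * Real.exp (s ^ 2 / 4) := by
    rw [← Real.exp_add]; ring_nf
  rw [e1, laplaceTruncation_eq, hsu, ← mul_sub, abs_mul, Real.abs_exp, e2]
  have h3 := (abs_sub_le _ _ _).trans (add_le_add h1 h2)
  exact (mul_le_mul_of_nonneg_left h3 (Real.exp_pos _).le).trans_eq (by ring)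

/-- Away from the minimum the truncation itself is negligible. -/
theorem exists_laplaceTruncation_far (Q : PowerSeries ℝ) (K : ℕ) {δ : ℝ} (hδ : 0 < δ) :
    ∃ C, 0 ≤ C ∧ ∀ ε s : ℝ, 0 < ε → δ ≤ |ε * s| →
      |laplaceTruncation Q K ε s| ≤
        C * ε ^ K * ((1 + |s|) ^ (3 * K) * Real.exp (-(s ^ 2 / 4))) := by
  refine ⟨∑ k ∈ Finset.range K, ∑ m ∈ Finset.range K,
    |PowerSeries.coeff m (Q ^ k)| * (δ ^ m / δ ^ K), by positivity, fun ε s hε hs => ?_⟩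
  rw [laplaceTruncation, Finset.sum_mul, Finset.sum_mul]
  refine (Finset.abs_sum_le_sum_abs _ _).trans (Finset.sum_le_sum fun k hk => ?_)
  rw [Finset.sum_mul, Finset.sum_mul]
  refine (Finset.abs_sum_le_sum_abs _ _).trans (Finset.sum_le_sum fun m hm => ?_)
  have hk' : k ≤ K := (Finset.mem_range.1 hk).le
  have hm' : m ≤ K := (Finset.mem_range.1 hm).le
  have hw1 : 1 ≤ 1 + |s| := by linarith [abs_nonneg s]
  rw [abs_mul ε, abs_of_pos hε] at hs
  have hfac : (1 : ℝ) ≤ k.factorial := by exact_mod_cast k.factorial_pos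
  have hc : |(-1 / 2 : ℝ) ^ k / k.factorial| ≤ 1 := by
    rw [abs_div, abs_pow, Nat.abs_cast]
    refine div_le_one_of_le₀ ((pow_le_one₀ (abs_nonneg _) ?_).trans hfac) (by positivity)
    norm_num [abs_div]
  have hu : (ε * |s|) ^ m ≤ δ ^ m / δ ^ K * (ε * |s|) ^ K := by
    have h1 : 1 ≤ ε * |s| / δ := (one_le_div hδ).2 hs
    have h2 := pow_le_pow_right₀ h1 hm'
    rw [div_pow, div_pow, div_le_div_iff₀ (by positivity) (by positivity)] at h2
    rw [div_mul_eq_mul_div, le_div_iff₀ (by positivity)]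
    linarith
  have hexp : Real.exp (-(s ^ 2 / 2)) ≤ Real.exp (-(s ^ 2 / 4)) :=
    Real.exp_le_exp.2 (by nlinarith [sq_nonneg s])
  calc _ = |(-1 / 2 : ℝ) ^ k / k.factorial| * |PowerSeries.coeff m (Q ^ k)| *
        ((ε * |s|) ^ m * |s| ^ (2 * k)) * Real.exp (-(s ^ 2 / 2)) := by
        simp only [abs_mul, Real.abs_exp, abs_pow, abs_of_pos hε, mul_pow, pow_add]
        ring
    _ ≤ 1 * |PowerSeries.coeff m (Q ^ k)| *
        ((δ ^ m / δ ^ K * (ε * |s|) ^ K) * (1 + |s|) ^ (2 * K)) * Real.exp (-(s ^ 2 / 4)) := by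
        gcongr ?_ * _ * (?_ * ?_) * ?_
        calc |s| ^ (2 * k) ≤ (1 + |s|) ^ (2 * k) := by gcongr; linarith
          _ ≤ _ := pow_le_pow_right₀ hw1 (by omega)
    _ ≤ 1 * |PowerSeries.coeff m (Q ^ k)| *
        ((δ ^ m / δ ^ K * (ε * (1 + |s|)) ^ K) * (1 + |s|) ^ (2 * K)) *
          Real.exp (-(s ^ 2 / 4)) := by
        gcongr
        linarith
    _ = _ := by
        rw [show 3 * K = 2 * K + K by ring, pow_add, mul_pow]; ring

/-- `E x` is a Laplace integrand with phase `φ`: near the minimum `0` it is `exp (-x φ(u))`, and it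
decays at least like `exp (-c x min(u ^ 2, |u|))` on the whole line for `x ≥ 1`. Extension by zero outside the
domain of `φ` is thereby permitted. -/
structure IsLaplaceIntegrand (E : ℝ → ℝ → ℝ) (φ : ℝ → ℝ) (c : ℝ) : Prop where
  pos : 0 < c
  aestronglyMeasurable : ∀ x, AEStronglyMeasurable (E x) volume
  abs_le : ∀ x, 1 ≤ x → ∀ u, |E x u| ≤ Real.exp (-(c * (x * min (u ^ 2) |u|)))
  eventually_eq : ∀ᶠ u in 𝓝[≠] 0, ∀ x, E x u = Real.exp (-(x * φ u))

theorem IsLaplaceIntegrand.abs_scaled_le {E : ℝ → ℝ → ℝ} {φ : ℝ → ℝ} {c : ℝ}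
    (hE : IsLaplaceIntegrand E φ c) {ε : ℝ} (hε : 0 < ε) (hε1 : ε ≤ 1) (s : ℝ) :
    |E (ε⁻¹ ^ 2) (ε * s)| ≤ Real.exp c * Real.exp (-(c * |s|)) := by
  have h1 : 1 ≤ ε⁻¹ := (one_le_inv₀ hε).2 hε1
  refine (hE.abs_le _ (one_le_pow₀ h1) _).trans ?_
  rw [← Real.exp_add]
  refine Real.exp_le_exp.2 ?_
  have h2 : |s| - 1 ≤ ε⁻¹ ^ 2 * min ((ε * s) ^ 2) |ε * s| := by
    rw [mul_min_of_nonneg _ _ (by positivity), abs_mul, abs_of_pos hε]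
    have e1 : ε⁻¹ ^ 2 * (ε * s) ^ 2 = s ^ 2 := by field_simp
    have e2 : ε⁻¹ ^ 2 * (ε * |s|) = ε⁻¹ * |s| := by field_simp
    rw [e1, e2]
    refine le_min ?_ ?_
    · nlinarith [sq_abs s, sq_nonneg (|s| - 1), abs_nonneg s]
    · nlinarith [abs_nonneg s]
  nlinarith [hE.pos]

/-- The global pointwise estimate, with an integrable majorant in the scaled variable. -/
theorem IsLaplaceIntegrand.exists_abs_sub_truncation_le {E : ℝ → ℝ → ℝ} {φ : ℝ → ℝ} {c : ℝ}
    (hE : IsLaplaceIntegrand E φ c) {P : PowerSeries ℝ} (hφ : HasTaylorSeries φ P)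
    (h0 : PowerSeries.coeff 0 P = 0) (h1 : PowerSeries.coeff 1 P = 0)
    (h2 : PowerSeries.coeff 2 P = 1 / 2) (K : ℕ) :
    ∃ C, 0 ≤ C ∧ ∀ ε s : ℝ, 0 < ε → ε ≤ 1 → s ≠ 0 →
      |E (ε⁻¹ ^ 2) (ε * s) - laplaceTruncation (normalizedPhase P - 1) K ε s| ≤
        C * ε ^ K * (1 + s ^ 2)⁻¹ := by
  have hQ : PowerSeries.coeff 0 (normalizedPhase P - 1) = 0 := by
    rw [map_sub, normalizedPhase, PowerSeries.coeff_mk, zero_add, h2]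
    simp
  obtain ⟨C₁, hC₁, hnear⟩ := exists_laplaceTruncation_near
    ((hφ.normalizedPhase h0 h1).sub hasTaylorSeries_one) hQ K
  obtain ⟨δ, hδ, hball⟩ := Metric.eventually_nhds_iff.1
    (eventually_nhdsWithin_iff.1 (hnear.and hE.eventually_eq))
  obtain ⟨C₂, hC₂, hfar⟩ := exists_laplaceTruncation_far (normalizedPhase P - 1) K hδ
  obtain ⟨W₁, hW₁, hw₁⟩ := exists_weight_bound (3 * K) one_pos
  obtain ⟨W₂, hW₂, hw₂⟩ := exists_weight_bound K hE.pos
  have hgauss : ∀ s : ℝ, (1 + |s|) ^ (3 * K) * Real.exp (-(s ^ 2 / 4)) ≤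
      Real.exp 1 * W₁ * (1 + s ^ 2)⁻¹ := fun s => by
    -- `s ^ 2 / 4 - |s| + 1 = (|s| / 2 - 1) ^ 2`
    have h : Real.exp (-(s ^ 2 / 4)) ≤ Real.exp 1 * Real.exp (-(1 * |s|)) := by
      rw [← Real.exp_add]
      exact Real.exp_le_exp.2 (by nlinarith [sq_nonneg (|s| / 2 - 1), sq_abs s])
    calc _ ≤ (1 + |s|) ^ (3 * K) * (Real.exp 1 * Real.exp (-(1 * |s|))) := by gcongr
      _ = Real.exp 1 * ((1 + |s|) ^ (3 * K) * Real.exp (-(1 * |s|))) := by ring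
      _ ≤ Real.exp 1 * (W₁ * (1 + s ^ 2)⁻¹) :=
        mul_le_mul_of_nonneg_left (hw₁ s) (by positivity)
      _ = _ := by ring
  refine ⟨(C₁ + C₂) * (Real.exp 1 * W₁) + Real.exp c / δ ^ K * W₂, by positivity,
    fun ε s hε hε1 hs => ?_⟩
  have hu0 : ε * s ≠ 0 := mul_ne_zero hε.ne' hs
  rcases lt_or_ge |ε * s| δ with hlt | hge
  · obtain ⟨ha, hb⟩ := hball (by simpa using hlt) hu0
    have e : ε⁻¹ ^ 2 * φ (ε * s) =
        s ^ 2 / 2 * (1 + (2 * φ (ε * s) / (ε * s) ^ 2 - 1)) := by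
      field_simp
      ring
    rw [hb, e]
    calc _ ≤ C₁ * ε ^ K * ((1 + |s|) ^ (3 * K) * Real.exp (-(s ^ 2 / 4))) := ha ε s hε rfl
      _ ≤ C₁ * ε ^ K * (Real.exp 1 * W₁ * (1 + s ^ 2)⁻¹) :=
        mul_le_mul_of_nonneg_left (hgauss s) (by positivity)
      _ = C₁ * (Real.exp 1 * W₁) * ε ^ K * (1 + s ^ 2)⁻¹ := by ring
      _ ≤ _ := by
        gcongr
        have : 0 ≤ C₂ * (Real.exp 1 * W₁) := by positivity
        have : 0 ≤ Real.exp c / δ ^ K * W₂ := by positivity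
        linarith
  · have hE1 : |E (ε⁻¹ ^ 2) (ε * s)| ≤ Real.exp c / δ ^ K * W₂ * ε ^ K * (1 + s ^ 2)⁻¹ := by
      -- Far from the minimum `1 ≤ (ε |s| / δ) ^ K`, so exponential decay alone gives order `ε ^ K`.
      have hd : 1 ≤ (ε * (1 + |s|)) ^ K / δ ^ K := by
        rw [← div_pow]
        refine one_le_pow₀ ((one_le_div hδ).2 (hge.trans ?_))
        rw [abs_mul, abs_of_pos hε]
        gcongr
        linarith
      calc _ ≤ Real.exp c * Real.exp (-(c * |s|)) := hE.abs_scaled_le hε hε1 s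
        _ ≤ Real.exp c * Real.exp (-(c * |s|)) * ((ε * (1 + |s|)) ^ K / δ ^ K) :=
          le_mul_of_one_le_right (by positivity) hd
        _ = Real.exp c / δ ^ K * ε ^ K * ((1 + |s|) ^ K * Real.exp (-(c * |s|))) := by
          rw [mul_pow]; ring
        _ ≤ Real.exp c / δ ^ K * ε ^ K * (W₂ * (1 + s ^ 2)⁻¹) :=
          mul_le_mul_of_nonneg_left (hw₂ s) (by positivity)
        _ = _ := by ring
    calc _ ≤ _ := abs_sub _ _
      _ ≤ Real.exp c / δ ^ K * W₂ * ε ^ K * (1 + s ^ 2)⁻¹ +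
          C₂ * ε ^ K * ((1 + |s|) ^ (3 * K) * Real.exp (-(s ^ 2 / 4))) :=
        add_le_add hE1 (hfar ε s hε hge)
      _ ≤ Real.exp c / δ ^ K * W₂ * ε ^ K * (1 + s ^ 2)⁻¹ +
          C₂ * ε ^ K * (Real.exp 1 * W₁ * (1 + s ^ 2)⁻¹) :=
        add_le_add_right (mul_le_mul_of_nonneg_left (hgauss s) (by positivity)) _
      _ = (C₂ * (Real.exp 1 * W₁) + Real.exp c / δ ^ K * W₂) * ε ^ K * (1 + s ^ 2)⁻¹ := by ring
      _ ≤ _ := by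
        gcongr
        have : 0 ≤ C₁ * (Real.exp 1 * W₁) := by positivity
        linarith

theorem integrable_laplaceTruncation (Q : PowerSeries ℝ) (K : ℕ) (ε : ℝ) :
    Integrable (laplaceTruncation Q K ε) :=
  integrable_finsetSum _ fun _ _ => integrable_finsetSum _ fun _ _ =>
    (integrable_pow_mul_gaussian _).const_mul _

theorem sum_range_two_mul_of_odd_eq_zero {f : ℕ → ℝ} (hf : ∀ m, Odd m → f m = 0) (N : ℕ) :
    ∑ m ∈ Finset.range (2 * N), f m = ∑ n ∈ Finset.range N, f (2 * n) := by
  induction N with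
  | zero => simp
  | succ N ih =>
    rw [Nat.mul_succ, Finset.sum_range_succ, Finset.sum_range_succ, ih, Finset.sum_range_succ,
      hf (2 * N + 1) ⟨N, rfl⟩, add_zero]

/-- Integration of the truncation term by term produces the Laplace coefficients; the odd powers of
`ε` disappear because the odd Gaussian moments vanish. -/
theorem integral_laplaceTruncation {P : PowerSeries ℝ}
    (h2 : PowerSeries.coeff 2 P = 1 / 2) (N : ℕ) (ε : ℝ) :
    ∫ s, laplaceTruncation (normalizedPhase P - 1) (2 * N) ε s =
      √(2 * Real.pi) * ∑ n ∈ Finset.range N, laplaceCoeff P n * (ε ^ 2) ^ n := by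
  set Q := normalizedPhase P - 1 with hQdef
  have hQ : PowerSeries.X ∣ Q := by
    rw [PowerSeries.X_dvd_iff, ← PowerSeries.coeff_zero_eq_constantCoeff_apply, hQdef, map_sub,
      normalizedPhase, PowerSeries.coeff_mk, zero_add, h2]
    simp
  simp only [laplaceTruncation]
  rw [integral_finsetSum _ fun _ _ => integrable_finsetSum _ fun _ _ =>
    (integrable_pow_mul_gaussian _).const_mul _]
  simp_rw [integral_finsetSum _ fun _ _ => (integrable_pow_mul_gaussian _).const_mul _,
    integral_const_mul]
  rw [Finset.sum_comm, sum_range_two_mul_of_odd_eq_zero, Finset.mul_sum]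
  · refine Finset.sum_congr rfl fun n hn => ?_
    have hn : n < N := Finset.mem_range.1 hn
    rw [laplaceCoeff, Finset.sum_subset (Finset.range_subset_range.2 (by omega : 2 * n + 1 ≤ 2 * N)),
      Finset.mul_sum, Finset.sum_mul, Finset.mul_sum]
    · refine Finset.sum_congr rfl fun k _ => ?_
      have e : 2 * k + 2 * n = 2 * (n + k) := by ring
      have e2 : (-1 / 2 : ℝ) ^ k * 2 ^ k = (-1) ^ k := by rw [← mul_pow]; norm_num
      have hpi : √Real.pi ≠ 0 := by positivity
      rw [e, integral_even_pow_mul_gaussian, Real.sqrt_mul (by norm_num), ← e2, pow_mul ε, pow_add]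
      push_cast
      field_simp
      rw [mul_comm]
    · intro k _ hk
      have hk : 2 * n < k := by simpa using hk
      have : PowerSeries.coeff (2 * n) (Q ^ k) = 0 :=
        PowerSeries.X_pow_dvd_iff.1 (pow_dvd_pow_of_dvd hQ k) _ hk
      rw [this, mul_zero]
  · intro m hm
    refine Finset.sum_eq_zero fun k _ => ?_
    rw [integral_odd_pow_mul_gaussian ((even_two_mul k).add_odd hm), mul_zero]

theorem IsLaplaceIntegrand.integrable_scaled {E : ℝ → ℝ → ℝ} {φ : ℝ → ℝ} {c : ℝ}
    (hE : IsLaplaceIntegrand E φ c) {ε : ℝ} (hε : 0 < ε) (hε1 : ε ≤ 1) :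
    Integrable fun s => E (ε⁻¹ ^ 2) (ε * s) := by
  obtain ⟨W, -, hw⟩ := exists_weight_bound 0 hE.pos
  have hqmp : Measure.QuasiMeasurePreserving (fun s : ℝ => ε * s) volume volume :=
    ⟨measurable_const_mul ε, by
      rw [Real.map_volume_mul_left hε.ne']
      exact Measure.smul_absolutelyContinuous⟩
  refine (integrable_inv_one_add_sq.const_mul (Real.exp c * W)).mono'
    ((hE.aestronglyMeasurable _).comp_quasiMeasurePreserving hqmp) (.of_forall fun s => ?_)
  rw [Real.norm_eq_abs, mul_assoc]
  refine (hE.abs_scaled_le hε hε1 s).trans (mul_le_mul_of_nonneg_left ?_ (Real.exp_pos _).le)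
  simpa using hw s

/-- Laplace's method: the integral has a full asymptotic expansion with the Laplace
coefficients of the Taylor series of the phase. -/
theorem IsLaplaceIntegrand.hasInversePowerExpansion {E : ℝ → ℝ → ℝ} {φ : ℝ → ℝ} {c : ℝ}
    (hE : IsLaplaceIntegrand E φ c) {P : PowerSeries ℝ} (hφ : HasTaylorSeries φ P)
    (h0 : PowerSeries.coeff 0 P = 0) (h1 : PowerSeries.coeff 1 P = 0)
    (h2 : PowerSeries.coeff 2 P = 1 / 2) :
    HasInversePowerExpansion (fun x => √x / √(2 * Real.pi) * ∫ u, E x u) (laplaceCoeff P) := by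
  intro N
  obtain ⟨C, hC, hbound⟩ := hE.exists_abs_sub_truncation_le hφ h0 h1 h2 (2 * N)
  refine .of_bound (C * Real.pi / √(2 * Real.pi)) ?_
  filter_upwards [eventually_ge_atTop (1 : ℝ)] with x hx
  have hx0 : 0 < x := by linarith
  -- The natural scale of the integrand is `u = ε s` with `ε = 1 / √x`.
  set ε := (√x)⁻¹ with hεdef
  have hsx : 1 ≤ √x := Real.one_le_sqrt.2 hx
  have hε : 0 < ε := by positivity
  have hε1 : ε ≤ 1 := inv_le_one_of_one_le₀ hsx
  have hεx : ε⁻¹ ^ 2 = x := by rw [hεdef, inv_inv, Real.sq_sqrt hx0.le]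
  have hε2 : ε ^ 2 = x⁻¹ := by rw [← hεx]; field_simp
  have hscale : √x * ∫ u, E x u = ∫ s, E (ε⁻¹ ^ 2) (ε * s) := by
    rw [Measure.integral_comp_mul_left, hεx, abs_of_pos (by positivity), smul_eq_mul, hεdef,
      inv_inv]
  have hdiff : |∫ s, (E (ε⁻¹ ^ 2) (ε * s) -
      laplaceTruncation (normalizedPhase P - 1) (2 * N) ε s)| ≤
      C * ε ^ (2 * N) * Real.pi := by
    rw [← integral_univ_inv_one_add_sq, ← integral_const_mul, ← Real.norm_eq_abs]
    refine norm_integral_le_of_norm_le (integrable_inv_one_add_sq.const_mul _) ?_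
    filter_upwards [Measure.ae_ne volume (0 : ℝ)] with s hs
    exact hbound ε s hε hε1 hs
  rw [integral_sub (hE.integrable_scaled hε hε1) (integrable_laplaceTruncation _ _ _), ← hscale,
    integral_laplaceTruncation h2, hε2, pow_mul, hε2] at hdiff
  have hpi : 0 < √(2 * Real.pi) := by positivity
  have e : √x / √(2 * Real.pi) * ∫ u, E x u = (√x * ∫ u, E x u) / √(2 * Real.pi) := by ring
  have e2 : (√x * ∫ u, E x u) / √(2 * Real.pi) -
      ∑ n ∈ Finset.range N, laplaceCoeff P n / x ^ n =
      (√x * (∫ u, E x u) - √(2 * Real.pi) *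
        ∑ n ∈ Finset.range N, laplaceCoeff P n * x⁻¹ ^ n) / √(2 * Real.pi) := by
    rw [sub_div, mul_div_cancel_left₀ _ hpi.ne']
    simp only [inv_pow, div_eq_mul_inv]
  rw [e, e2, norm_div, Real.norm_eq_abs, Real.norm_of_nonneg hpi.le,
    Real.norm_of_nonneg (by positivity), div_le_iff₀ hpi]
  refine hdiff.trans_eq ?_
  rw [inv_pow]
  field_simp

/-! ### Uniqueness of asymptotic expansions -/

theorem HasInversePowerExpansion.congr {f g : ℝ → ℝ} {c : ℕ → ℝ}
    (hf : HasInversePowerExpansion f c) (h : f =ᶠ[atTop] g) : HasInversePowerExpansion g c :=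
  fun N => (hf N).congr' (h.mono fun x hx => by simp only [hx]) .rfl

theorem HasInversePowerExpansion.unique {f : ℝ → ℝ} {c d : ℕ → ℝ}
    (hc : HasInversePowerExpansion f c) (hd : HasInversePowerExpansion f d) (n : ℕ) :
    c n = d n := by
  induction n using Nat.strong_induction_on with
  | _ n ih =>
    have h := ((hd (n + 1)).sub (hc (n + 1))).mul
      (isBigO_refl (fun x : ℝ => x ^ n) atTop)
    have hlim : Tendsto (fun x : ℝ => 1 / x ^ (n + 1) * x ^ n) atTop (𝓝 0) := by
      refine tendsto_inv_atTop_zero.congr' ?_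
      filter_upwards [eventually_gt_atTop 0] with x hx
      field_simp
      ring
    have hconst : (fun _ : ℝ => c n - d n) =ᶠ[atTop] fun x : ℝ =>
        (f x - ∑ i ∈ Finset.range (n + 1), d i / x ^ i -
          (f x - ∑ i ∈ Finset.range (n + 1), c i / x ^ i)) * x ^ n := by
      filter_upwards [eventually_gt_atTop 0] with x hx
      have hsum : ∑ i ∈ Finset.range n, c i / x ^ i = ∑ i ∈ Finset.range n, d i / x ^ i :=
        Finset.sum_congr rfl fun i hi => by rw [ih i (Finset.mem_range.1 hi)]
      rw [Finset.sum_range_succ, Finset.sum_range_succ, hsum]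
      field_simp
      ring
    have := (h.trans_tendsto hlim).congr' hconst.symm
    exact sub_eq_zero.1 (tendsto_const_nhds_iff.1 this)

/-! ### Two Laplace integrals for the Gamma function -/

theorem min_sq_abs_le_exp_sub (u : ℝ) : 1 / 4 * min (u ^ 2) |u| ≤ Real.exp u - 1 - u := by
  rcases le_total 0 u with hu | hu
  · have := Real.quadratic_le_exp_of_nonneg hu
    nlinarith [min_le_left (u ^ 2) |u|, sq_nonneg u]
  · rw [abs_of_nonpos hu]
    rcases le_total (-2) u with h | h
    · have h1 := Real.add_one_le_exp (u / 2)
      have h2 : Real.exp u = Real.exp (u / 2) * Real.exp (u / 2) := by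
        rw [← Real.exp_add]; ring_nf
      have h3 : (u / 2 + 1) * (u / 2 + 1) ≤ Real.exp u := by
        rw [h2]
        exact mul_self_le_mul_self (by linarith) h1
      nlinarith [min_le_left (u ^ 2) (-u)]
    · nlinarith [min_le_right (u ^ 2) (-u), Real.exp_pos u]

theorem min_sq_abs_le_neg_log_sub {w : ℝ} (hw : w < 1) :
    1 / 6 * min (w ^ 2) |w| ≤ -Real.log (1 - w) - w := by
  -- `log r ≤ r - 1` at `r = √(1 - w)` bounds the phase below by `(r - 1) ^ 2`.
  set r := √(1 - w) with hr
  have hr0 : 0 < r := Real.sqrt_pos.2 (by linarith)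
  have hr2 : r ^ 2 = 1 - w := Real.sq_sqrt (by linarith)
  have hlog : Real.log (1 - w) ≤ 2 * (r - 1) := by
    rw [← hr2, Real.log_pow]
    push_cast
    linarith [Real.log_le_sub_one_of_pos hr0]
  have h1 : (r - 1) ^ 2 ≤ -Real.log (1 - w) - w := by nlinarith
  have h2 : (r + 1) ^ 2 ≤ 2 * (2 + |w|) := by nlinarith [sq_nonneg (r - 1), neg_abs_le w]
  have h3 : w ^ 2 = (r - 1) ^ 2 * (r + 1) ^ 2 := by
    rw [← mul_pow, show (r - 1) * (r + 1) = r ^ 2 - 1 by ring, hr2]; ring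
  have h4 : w ^ 2 ≤ (r - 1) ^ 2 * (2 * (2 + |w|)) := by
    rw [h3]; gcongr
  refine le_trans ?_ h1
  rcases le_total |w| 1 with h | h
  · nlinarith [min_le_left (w ^ 2) |w|, sq_nonneg (r - 1)]
  · have h5 : |w| * |w| ≤ (r - 1) ^ 2 * 6 * |w| := by
      rw [← sq, sq_abs]
      nlinarith [sq_nonneg (r - 1)]
    have h6 := le_of_mul_le_mul_right h5 (by linarith)
    linarith [min_le_right (w ^ 2) |w|]

theorem isLaplaceIntegrand_exp :
    IsLaplaceIntegrand (fun x u => Real.exp (-(x * (Real.exp u - 1 - u))))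
      (fun u => Real.exp u - 1 - u) (1 / 4) where
  pos := by norm_num
  aestronglyMeasurable x := (by fun_prop : Continuous fun u =>
    Real.exp (-(x * (Real.exp u - 1 - u)))).aestronglyMeasurable
  abs_le x hx u := by
    rw [Real.abs_exp]
    refine Real.exp_le_exp.2 (neg_le_neg ?_)
    rw [mul_left_comm]
    exact mul_le_mul_of_nonneg_left (min_sq_abs_le_exp_sub u) (by linarith)
  eventually_eq := .of_forall fun _ _ => rfl

theorem isLaplaceIntegrand_log :
    IsLaplaceIntegrand
      (fun x => (Set.Iio 1).indicator fun w => Real.exp (-(x * (-Real.log (1 - w) - w))))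
      (fun w => -Real.log (1 - w) - w) (1 / 6) where
  pos := by norm_num
  aestronglyMeasurable x := by
    refine (Measurable.indicator ?_ measurableSet_Iio).aestronglyMeasurable
    fun_prop
  abs_le x hx w := by
    rcases lt_or_ge w 1 with hw | hw
    · rw [Set.indicator_of_mem (Set.mem_Iio.2 hw), Real.abs_exp]
      refine Real.exp_le_exp.2 (neg_le_neg ?_)
      rw [mul_left_comm]
      exact mul_le_mul_of_nonneg_left (min_sq_abs_le_neg_log_sub hw) (by linarith)
    · rw [Set.indicator_of_notMem (by simpa using hw), abs_zero]
      exact (Real.exp_pos _).le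
  eventually_eq := by
    filter_upwards [nhdsWithin_le_nhds (Iio_mem_nhds (zero_lt_one' ℝ))] with w hw x
    rw [Set.indicator_of_mem hw]

theorem integral_exp_phase {x : ℝ} (hx : 0 < x) :
    ∫ u, Real.exp (-(x * (Real.exp u - 1 - u))) = Real.exp x * x ^ (-x) * Real.Gamma x := by
  have h := integral_image_eq_integral_abs_deriv_smul (s := Set.univ) MeasurableSet.univ
    (fun u _ => (Real.hasDerivAt_exp u).hasDerivWithinAt) Real.exp_injective.injOn
    (fun t => t ^ (x - 1) * Real.exp (-(x * t)))
  rw [Set.image_univ, Real.range_exp, Real.integral_rpow_mul_exp_neg_mul_Ioi hx hx,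
    setIntegral_univ, one_div, Real.inv_rpow hx.le, ← Real.rpow_neg hx.le] at h
  rw [mul_assoc, h, ← integral_const_mul]
  congr 1
  ext u
  rw [Real.abs_exp, smul_eq_mul, ← Real.exp_mul, ← Real.exp_add, ← Real.exp_add, ← Real.exp_add]
  ring_nf

/-- This is the integral for `Γ(x + 1) = x Γ(x)`, which removes the factor `1 / (1 - w)` that the
integral for `Γ(x)` would carry. -/
theorem integral_log_phase {x : ℝ} (hx : 0 < x) :
    ∫ w, (Set.Iio 1).indicator (fun w => Real.exp (-(x * (-Real.log (1 - w) - w)))) w =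
      Real.exp x * x ^ (-x) * Real.Gamma x := by
  have h := Real.integral_rpow_mul_exp_neg_mul_Ioi (a := x + 1) (by linarith) hx
  rw [Real.Gamma_add_one hx.ne', add_sub_cancel_right, one_div, Real.inv_rpow hx.le,
    ← Real.rpow_neg hx.le, neg_add, Real.rpow_add hx, Real.rpow_neg_one,
    show x ^ (-x) * x⁻¹ * (x * Real.Gamma x) = x ^ (-x) * Real.Gamma x by field_simp,
    ← integral_indicator measurableSet_Ioi, ← integral_sub_left_eq_self _ volume 1] at h
  rw [mul_assoc, ← h, ← integral_const_mul]
  congr 1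
  ext w
  rcases lt_or_ge w 1 with hw | hw
  · have hw' : 0 < 1 - w := by linarith
    rw [Set.indicator_of_mem (Set.mem_Iio.2 hw), Set.indicator_of_mem (Set.mem_Ioi.2 hw'),
      Real.rpow_def_of_pos hw', ← Real.exp_add, ← Real.exp_add]
    ring_nf
  · rw [Set.indicator_of_notMem (by simpa using hw), Set.indicator_of_notMem (by simpa using hw),
      mul_zero]

theorem sqrt_div_mul_eq_Gamma_div {x : ℝ} (hx : 0 < x) :
    √x / √(2 * Real.pi) * (Real.exp x * x ^ (-x) * Real.Gamma x) =
      Real.Gamma x / (√(2 * Real.pi) * x ^ (x - 1 / 2) * Real.exp (-x)) := by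
  have h : x ^ (x - 1 / 2) = x ^ x / √x := by rw [Real.rpow_sub hx, Real.sqrt_eq_rpow]
  have h1 : 0 < x ^ x := Real.rpow_pos_of_pos hx x
  rw [h, Real.rpow_neg hx.le, Real.exp_neg]
  field_simp

theorem Gamma_hasInversePowerExpansion_of_integral {E : ℝ → ℝ → ℝ} {φ : ℝ → ℝ} {c : ℝ}
    (hE : IsLaplaceIntegrand E φ c)
    (hint : ∀ x, 0 < x → ∫ u, E x u = Real.exp x * x ^ (-x) * Real.Gamma x) {P : PowerSeries ℝ}
    (hφ : HasTaylorSeries φ P) (h0 : PowerSeries.coeff 0 P = 0)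
    (h1 : PowerSeries.coeff 1 P = 0) (h2 : PowerSeries.coeff 2 P = 1 / 2) :
    HasInversePowerExpansion
      (fun x : ℝ => Real.Gamma x / (√(2 * Real.pi) * x ^ (x - 1 / 2) * Real.exp (-x)))
      (laplaceCoeff P) := by
  refine (hE.hasInversePowerExpansion hφ h0 h1 h2).congr ?_
  filter_upwards [eventually_gt_atTop 0] with x hx
  rw [hint x hx, sqrt_div_mul_eq_Gamma_div hx]

/-! ### The two phase series -/

theorem coeff_zero_expPhase : PowerSeries.coeff 0 (PowerSeries.exp ℝ - 1 - PowerSeries.X) = 0 := by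
  simp

theorem coeff_one_expPhase : PowerSeries.coeff 1 (PowerSeries.exp ℝ - 1 - PowerSeries.X) = 0 := by
  simp [PowerSeries.coeff_exp, PowerSeries.coeff_one]

theorem coeff_two_expPhase :
    PowerSeries.coeff 2 (PowerSeries.exp ℝ - 1 - PowerSeries.X) = 1 / 2 := by
  simp [PowerSeries.coeff_exp, PowerSeries.coeff_one, PowerSeries.coeff_X]

theorem coeff_zero_logPhase : PowerSeries.coeff 0 (negLogOneSub - PowerSeries.X) = 0 := by
  rw [map_sub, negLogOneSub, PowerSeries.coeff_mk, PowerSeries.coeff_X]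
  simp

theorem coeff_one_logPhase : PowerSeries.coeff 1 (negLogOneSub - PowerSeries.X) = 0 := by
  rw [map_sub, negLogOneSub, PowerSeries.coeff_mk, PowerSeries.coeff_X]
  simp

theorem coeff_two_logPhase : PowerSeries.coeff 2 (negLogOneSub - PowerSeries.X) = 1 / 2 := by
  rw [map_sub, negLogOneSub, PowerSeries.coeff_mk, PowerSeries.coeff_X]
  simp

theorem Gamma_hasInversePowerExpansion_exp :
    HasInversePowerExpansion
      (fun x : ℝ => Real.Gamma x / (√(2 * Real.pi) * x ^ (x - 1 / 2) * Real.exp (-x)))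
      (laplaceCoeff (PowerSeries.exp ℝ - 1 - PowerSeries.X)) :=
  Gamma_hasInversePowerExpansion_of_integral isLaplaceIntegrand_exp
    (fun _ => integral_exp_phase)
    ((hasTaylorSeries_exp.sub hasTaylorSeries_one).sub hasTaylorSeries_id)
    coeff_zero_expPhase coeff_one_expPhase coeff_two_expPhase

theorem Gamma_hasInversePowerExpansion_log :
    HasInversePowerExpansion
      (fun x : ℝ => Real.Gamma x / (√(2 * Real.pi) * x ^ (x - 1 / 2) * Real.exp (-x)))
      (laplaceCoeff (negLogOneSub - PowerSeries.X)) :=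
  Gamma_hasInversePowerExpansion_of_integral isLaplaceIntegrand_log
    (fun _ => integral_log_phase) (hasTaylorSeries_negLogOneSub.sub hasTaylorSeries_id)
    coeff_zero_logPhase coeff_one_logPhase coeff_two_logPhase

/-! ### The formulas for the Stirling coefficients -/

theorem neg_one_pow_mul_self_mul (n : ℕ) (a : ℝ) : (-1) ^ n * ((-1) ^ n * a) = a := by
  rw [← mul_assoc, ← mul_pow]
  norm_num

theorem mainTheorem2 :
    (∃ γ : ℕ → ℝ, IsStirlingCoefficients γ) ∧
    ∀ γ : ℕ → ℝ, IsStirlingCoefficients γ → ∀ n : ℕ,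
      γ n = ∑ k ∈ Finset.range (2 * n + 1),
        ((-1 : ℝ) ^ n * 2 ^ (n + k + 1) * Real.Gamma (3 * (n : ℝ) + 3 / 2) /
          (√Real.pi * (2 * (n : ℝ) + 2 * (k : ℝ) + 1) * ((2 * n - k).factorial : ℝ))) *
        ∑ j ∈ Finset.range (k + 1),
          (-1 : ℝ) ^ j * (Nat.stirlingFirst (2 * n + k + j) j : ℝ) /
            (((k - j).factorial : ℝ) * ((2 * n + k + j).factorial : ℝ)) ∧
      γ n = ∑ k ∈ Finset.range (2 * n + 1),
        ((-1 : ℝ) ^ n * 2 ^ n * Real.Gamma ((n : ℝ) + (k : ℝ) + 1 / 2) / √Real.pi) *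
        ∑ j ∈ Finset.range (k + 1),
          ((2 : ℝ) ^ j / ((k - j).factorial : ℝ)) *
          ∑ i ∈ Finset.range (j + 1),
            (-1 : ℝ) ^ i * (Nat.stirlingSecond (2 * n + j + i) i : ℝ) /
              (((j - i).factorial : ℝ) * ((2 * n + j + i).factorial : ℝ)) := by
  refine ⟨⟨fun n => (-1) ^ n * laplaceCoeff (PowerSeries.exp ℝ - 1 - PowerSeries.X) n, ?_⟩,
    fun γ hγ n => ⟨?_, ?_⟩⟩
  · simp only [IsStirlingCoefficients, neg_one_pow_mul_self_mul]
    exact Gamma_hasInversePowerExpansion_exp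
  · rw [← neg_one_pow_mul_self_mul n (γ n),
      HasInversePowerExpansion.unique hγ Gamma_hasInversePowerExpansion_log n,
      laplaceCoeff_eq_single_sum coeff_zero_logPhase coeff_one_logPhase, Finset.mul_sum,
      Finset.mul_sum]
    refine Finset.sum_congr rfl fun k _ => ?_
    rw [coeff_sub_X_pow_of_array coeff_negLogOneSub_pow]
    have hk := k.factorial_ne_zero
    have hs : (-1 : ℝ) ^ k * (-1) ^ k = 1 := by rw [← mul_pow]; norm_num
    have h1 : (n : ℝ) + 1 / 2 + k = (2 * n + 2 * k + 1) / 2 := by ring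
    have h2 : (2 * n + 2 * k + 1 : ℝ) ≠ 0 := by positivity
    rw [h1, pow_succ, pow_add]
    generalize (∑ j ∈ Finset.range (k + 1), _ : ℝ) = S
    field_simp
    linear_combination S * hs
  · rw [← neg_one_pow_mul_self_mul n (γ n),
      HasInversePowerExpansion.unique hγ Gamma_hasInversePowerExpansion_exp n,
      laplaceCoeff_eq_sum_phase_pow coeff_zero_expPhase coeff_one_expPhase, Finset.mul_sum,
      Finset.mul_sum]
    refine Finset.sum_congr rfl fun k _ => ?_
    rw [Finset.mul_sum, Finset.mul_sum, Finset.mul_sum]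
    refine Finset.sum_congr rfl fun j _ => ?_
    rw [coeff_sub_X_pow_of_array coeff_exp_sub_one_pow]
    have hj := j.factorial_ne_zero
    have hs : (-1 : ℝ) ^ j * (-1) ^ j = 1 := by rw [← mul_pow]; norm_num
    generalize (∑ i ∈ Finset.range (j + 1), _ : ℝ) = S
    field_simp
    linear_combination S * hs
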